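/- A similarity matrix on a finite nonempty set $X$ is a symmetric function $M\colon X\times X\to[0,\infty)$. A cluster tree $T$ on $X$ is a full rooted binary tree whose leaves are in bijection with $X$; for an internal node $v$ with children $v_+,v_-$ let $L(T_{v_\pm})\subseteq X$ be the set of leaves below $v_\pm$. For real numbers $\lambda,\mu,\nu$ put $$g(a,b)=\lambda\bigl((a+b)^3-(a+b)ab\bigr)+\mu\bigl(2(a+b)^2-ab\bigr)+\nu(a+b)$$ and $$\Gamma(T)=\sum_{v\text{ internal}}\Bigl(\sum_{x\in L(T_{v_+}),\,y\in L(T_{v_-})}M(x,y)\Bigr)\,g\bigl(|L(T_{v_+})|,|L(T_{v_-})|\bigr).$$ For $A\subseteq X$ with $|A|\ge 2$, the density of a bipartition $\{Y,A\setminus Y\}$ of $A$ into nonempty sets is $\frac{1}{|Y|\,|A\setminus Y|}\sum_{x\in Y,\,y\in A\setminus Y}M(x,y)$; a $\phi$-sparsest cut of $A$ is such a bipartition whose density is at most $\phi$ times the minimum density over all bipartitions of $A$ into nonempty sets. The recursive sparsest cut algorithm with a $\phi$-approximate subroutine, run on $A=X$, returns the single-leaf tree if $|A|=1$; otherwise it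 calls the subroutine to obtain a $\phi$-sparsest cut $\{Y,A\setminus Y\}$ of $A$, recursively computes trees on $Y$ and on $A\setminus Y$, and returns the tree whose root has these two trees as its children. **Theorem.** Let $\lambda\ge 0$, $\mu\ge 0$ and $\lambda+2\mu+\nu>0$. There is a constant $C>0$, depending only on $\lambda,\mu,\nu$, such that for every finite nonempty set $X$, every similarity matrix $M$ on $X$, every $\phi\ge 1$ and every $\phi$-approximate sparsest-cut subroutine, the recursive sparsest cut algorithm outputs a cluster tree $T_{\mathrm{RSC}}$ on $X$ with $$\Gamma(T_{\mathrm{RSC}})\le C\,\phi\cdot\min_{T}\Gamma(T),$$ the minimum being over all cluster trees $T$ on $X$. -/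

import Mathlib

/-- Full binary trees (every internal node has a left and a right child) whose leaves are
labelled by elements of `X`. -/
inductive BinTree (X : Type*) where
  | leaf (x : X) : BinTree X
  | node (l r : BinTree X) : BinTree X

namespace BinTree

variable {X : Type*} [DecidableEq X]

/-- The set `L(T)` of labels of the leaves. -/
def leaves : BinTree X → Finset X
  | leaf x => {x}
  | node l r => l.leaves ∪ r.leaves

/-- No element of `X` labels two different leaves. -/
def DistinctLeaves : BinTree X → Prop
  | leaf _ => True
  | node l r => Disjoint l.leaves r.leaves ∧ l.DistinctLeaves ∧ r.DistinctLeaves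

/-- `T` is a cluster tree on the set `A`: its leaves are, bijectively, the elements of `A`. -/
def IsClusterTreeOn (T : BinTree X) (A : Finset X) : Prop :=
  T.DistinctLeaves ∧ T.leaves = A

/-- The sum-type objective
`Γ(T) = ∑_v H_T(v₊, v₋) * g(|L(T_{v₊})|, |L(T_{v₋})|)`, the sum being over the internal nodes `v`
of `T`, where `H_T(v₊, v₋) = ∑_{x ∈ L(T_{v₊}), y ∈ L(T_{v₋})} M(x, y)`. -/
def sumCost (M : X → X → ℝ) (g : ℕ → ℕ → ℝ) : BinTree X → ℝ
  | leaf _ => 0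
  | node l r =>
      (∑ x ∈ l.leaves, ∑ y ∈ r.leaves, M x y) * g l.leaves.card r.leaves.card
        + l.sumCost M g + r.sumCost M g

end BinTree

/-- A similarity matrix on `X`: a symmetric function with nonnegative real values. -/
def IsSimilarityMatrix {X : Type*} (M : X → X → ℝ) : Prop :=
  (∀ x y, M x y = M y x) ∧ ∀ x y, 0 ≤ M x y

/-- The scaling function
`g(a, b) = lam ((a+b)³ - (a+b)ab) + mu (2(a+b)² - ab) + nu (a+b)`. -/
def cubicScaling (lam mu nu : ℝ) (a b : ℕ) : ℝ :=
  lam * (((a : ℝ) + b) ^ 3 - ((a : ℝ) + b) * a * b)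
    + mu * (2 * ((a : ℝ) + b) ^ 2 - (a : ℝ) * b)
    + nu * ((a : ℝ) + b)

section SparsestCut

variable {X : Type*} [DecidableEq X]

/-- `{Y, A \ Y}` is a bipartition of `A` into two nonempty parts. -/
def IsCut (A Y : Finset X) : Prop :=
  Y.Nonempty ∧ Y ⊂ A

/-- The density of the cut `{Y, A \ Y}` of the submatrix of `M` on `A`. -/
noncomputable def cutDensity (M : X → X → ℝ) (A Y : Finset X) : ℝ :=
  (∑ x ∈ Y, ∑ y ∈ A \ Y, M x y) / ((Y.card : ℝ) * ((A \ Y).card : ℝ))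

/-- `{Y, A \ Y}` is a `φ`-sparsest cut of the submatrix of `M` on `A`: its density is at most `φ`
times the density of every cut of `A`, hence at most `φ` times the minimum density. -/
def IsSparsestCut (M : X → X → ℝ) (φ : ℝ) (A Y : Finset X) : Prop :=
  IsCut A Y ∧ ∀ Z, IsCut A Z → cutDensity M A Y ≤ φ * cutDensity M A Z

/-- A subroutine that returns, for every `A` with at least two elements, (one part of) a cut
of `A`. -/
structure CutSubroutine (X : Type*) [DecidableEq X] where
  cut : Finset X → Finset X
  isCut : ∀ A : Finset X, 2 ≤ A.card → IsCut A (cut A)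

/-- The subroutine is a `φ`-approximate sparsest cut subroutine for the similarity matrix `M`:
on each submatrix of `M` with at least two rows it returns a `φ`-sparsest cut. -/
def CutSubroutine.IsApprox (S : CutSubroutine X) (M : X → X → ℝ) (φ : ℝ) : Prop :=
  ∀ A : Finset X, 2 ≤ A.card → IsSparsestCut M φ A (S.cut A)

theorem IsCut.card_lt {A Y : Finset X} (h : IsCut A Y) : Y.card < A.card :=
  Finset.card_lt_card h.2

theorem IsCut.sdiff_nonempty {A Y : Finset X} (h : IsCut A Y) : (A \ Y).Nonempty :=
  Finset.sdiff_nonempty.mpr h.2.2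

theorem IsCut.card_sdiff_lt {A Y : Finset X} (h : IsCut A Y) : (A \ Y).card < A.card := by
  have h1 := Finset.card_sdiff_add_card_eq_card h.2.1
  have h2 := h.1.card_pos
  omega

/-- The recursive sparsest cut algorithm, run with the subroutine `S` on the nonempty set `A`:
return the single-leaf tree if `A` is a singleton; otherwise split `A` with `S`, recurse on the
two parts, and join the two resulting trees at a new root. -/
noncomputable def recursiveSparsestCut (S : CutSubroutine X) (A : Finset X) (hA : A.Nonempty) :
    BinTree X :=
  if h : 2 ≤ A.card then
    BinTree.node
      (recursiveSparsestCut S (S.cut A) (S.isCut A h).1)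
      (recursiveSparsestCut S (A \ S.cut A) (S.isCut A h).sdiff_nonempty)
  else
    BinTree.leaf hA.choose
termination_by A.card
decreasing_by
  · exact (S.isCut A h).card_lt
  · exact (S.isCut A h).card_sdiff_lt

end SparsestCut

/-! For a, b ≥ 1 the scaling function is comparable to (a+b)^(k+1), where k+1 is 3, 2 or 1, so Γ(T)
is comparable to the sum over pairs of M(x,y) times the (k+1)-st power of the size of their least
common subtree. Any T yields a balanced cut Z of A whose separated pairs all have common subtrees of
size at least |A|/2 (`exists_balanced_subset`). A φ-sparsest cut is at most φ times as dense as Z,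
which bounds its weight. To sum these bounds over the recursion, truncate: take the pair sum over A
of M(x,y) min(|A|, 2 `lcaSize`)^(k+1). Lowering the level from |A| to the size m of the larger part
loses enough on the pairs cut by Z to pay for the cut of A (`IsSparsestCut.charge`), and what
remains at level m dominates the truncated sums of both parts. The payments telescope, with no
logarithmic loss. -/

namespace BinTree

variable {X : Type*} [DecidableEq X]

/-! ### Least common subtrees, balanced cuts and the lower bound -/

/-- The number of leaves of the smallest subtree of `T` containing both `x` and `y`
(and `0` if this subtree is a single leaf). -/
def lcaSize : BinTree X → X → X → ℕ
  | leaf _, _, _ => 0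
  | node l r, x, y =>
      if x ∈ l.leaves ∧ y ∈ l.leaves then l.lcaSize x y
      else if x ∈ r.leaves ∧ y ∈ r.leaves then r.lcaSize x y
      else (l.leaves ∪ r.leaves).card

theorem leaves_nonempty (T : BinTree X) : T.leaves.Nonempty := by
  induction T with
  | leaf x => exact Finset.singleton_nonempty x
  | node l r hl _ => exact hl.mono Finset.subset_union_left

section lcaSize

variable {l r : BinTree X} {x y : X}

theorem lcaSize_node_left (hx : x ∈ l.leaves) (hy : y ∈ l.leaves) :
    (node l r).lcaSize x y = l.lcaSize x y := by
  simp [lcaSize, hx, hy]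

theorem lcaSize_node_right (h : Disjoint l.leaves r.leaves) (hx : x ∈ r.leaves)
    (hy : y ∈ r.leaves) : (node l r).lcaSize x y = r.lcaSize x y := by
  simp [lcaSize, hx, hy, Finset.disjoint_right.mp h hx]

theorem lcaSize_node_left_right (h : Disjoint l.leaves r.leaves) (hx : x ∈ l.leaves)
    (hy : y ∉ l.leaves) : (node l r).lcaSize x y = (l.leaves ∪ r.leaves).card := by
  simp [lcaSize, hy, Finset.disjoint_left.mp h hx]

theorem lcaSize_node_right_left (h : Disjoint l.leaves r.leaves) (hx : x ∈ r.leaves)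
    (hy : y ∉ r.leaves) : (node l r).lcaSize x y = (l.leaves ∪ r.leaves).card := by
  simp [lcaSize, hy, Finset.disjoint_right.mp h hx]

end lcaSize

/-- Among the sets `A ∩ L`, with `L` the leaf set of a subtree of `T`, there is one that contains
between one and two thirds of `A` and is separated from the rest of `A` only at large subtrees. -/
theorem exists_balanced_subset (T : BinTree X) (hT : T.DistinctLeaves) (A : Finset X)
    (hA : 2 ≤ A.card) (h : 2 * A.card < 3 * (A ∩ T.leaves).card) :
    ∃ Z ⊆ A ∩ T.leaves, A.card ≤ 3 * Z.card ∧ 3 * Z.card ≤ 2 * A.card ∧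
      ∀ x ∈ Z, ∀ y ∈ A ∩ T.leaves, y ∉ Z → 2 * A.card < 3 * T.lcaSize x y := by
  induction T with
  | leaf x =>
    have : (A ∩ (leaf x).leaves).card ≤ 1 :=
      (Finset.card_le_card Finset.inter_subset_right).trans_eq (Finset.card_singleton x)
    omega
  | node l r ihl ihr =>
    obtain ⟨hd, hl, hr⟩ := hT
    have hle : (A ∩ (l.leaves ∪ r.leaves)).card ≤ (l.leaves ∪ r.leaves).card :=
      Finset.card_le_card Finset.inter_subset_right
    have hadd : (A ∩ (l.leaves ∪ r.leaves)).card ≤ (A ∩ l.leaves).card + (A ∩ r.leaves).card := by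
      rw [Finset.inter_union_distrib_left]
      exact Finset.card_union_le _ _
    have hsl : A ∩ l.leaves ⊆ A ∩ (node l r).leaves :=
      Finset.inter_subset_inter_left Finset.subset_union_left
    have hsr : A ∩ r.leaves ⊆ A ∩ (node l r).leaves :=
      Finset.inter_subset_inter_left Finset.subset_union_right
    simp only [leaves] at h
    by_cases hbl : 2 * A.card < 3 * (A ∩ l.leaves).card
    · obtain ⟨Z, hZ, h1, h2, h3⟩ := ihl hl hbl
      refine ⟨Z, hZ.trans hsl, h1, h2, fun x hx y hy hyZ => ?_⟩
      have hxl := (Finset.mem_inter.mp (hZ hx)).2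
      by_cases hyl : y ∈ l.leaves
      · rw [lcaSize_node_left hxl hyl]
        exact h3 x hx y (Finset.mem_inter.mpr ⟨(Finset.mem_inter.mp hy).1, hyl⟩) hyZ
      · rw [lcaSize_node_left_right hd hxl hyl]
        omega
    by_cases hbr : 2 * A.card < 3 * (A ∩ r.leaves).card
    · obtain ⟨Z, hZ, h1, h2, h3⟩ := ihr hr hbr
      refine ⟨Z, hZ.trans hsr, h1, h2, fun x hx y hy hyZ => ?_⟩
      have hxr := (Finset.mem_inter.mp (hZ hx)).2
      by_cases hyr : y ∈ r.leaves
      · rw [lcaSize_node_right hd hxr hyr]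
        exact h3 x hx y (Finset.mem_inter.mpr ⟨(Finset.mem_inter.mp hy).1, hyr⟩) hyZ
      · rw [lcaSize_node_right_left hd hxr hyr]
        omega
    -- Neither child holds more than two thirds of A but together they do, so the larger share
    -- exceeds one third. Pairs split here have the whole node as common subtree, with more than
    -- 2|A|/3 leaves.
    rcases le_total (A ∩ r.leaves).card (A ∩ l.leaves).card with hlr | hlr
    · refine ⟨A ∩ l.leaves, hsl, by omega, by omega, fun x hx y hy hyZ => ?_⟩
      have hyl : y ∉ l.leaves := fun hyl =>
        hyZ (Finset.mem_inter.mpr ⟨(Finset.mem_inter.mp hy).1, hyl⟩)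
      rw [lcaSize_node_left_right hd (Finset.mem_inter.mp hx).2 hyl]
      omega
    · refine ⟨A ∩ r.leaves, hsr, by omega, by omega, fun x hx y hy hyZ => ?_⟩
      have hyr : y ∉ r.leaves := fun hyr =>
        hyZ (Finset.mem_inter.mpr ⟨(Finset.mem_inter.mp hy).1, hyr⟩)
      rw [lcaSize_node_right_left hd (Finset.mem_inter.mp hx).2 hyr]
      omega

/-- A lower bound on the objective by a sum over ordered pairs of leaves. -/
theorem sum_lcaSize_pow_le_sumCost {M : X → X → ℝ} (hM : IsSimilarityMatrix M) {g : ℕ → ℕ → ℝ}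
    {c : ℝ} {k : ℕ} (hg : ∀ a b : ℕ, 1 ≤ a → 1 ≤ b → c * ((a : ℝ) + b) ^ (k + 1) ≤ g a b)
    (T : BinTree X) (hT : T.DistinctLeaves) :
    c * ∑ x ∈ T.leaves, ∑ y ∈ T.leaves, M x y * (T.lcaSize x y : ℝ) ^ (k + 1)
      ≤ 2 * T.sumCost M g := by
  induction T with
  -- The exponent k + 1 is positive, so the value 0 of `lcaSize` on a leaf removes the diagonal.
  | leaf x => simp [leaves, lcaSize, sumCost]
  | node l r ihl ihr =>
    obtain ⟨hd, hl, hr⟩ := hT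
    have ihl := ihl hl
    have ihr := ihr hr
    have hcard : ((l.leaves ∪ r.leaves).card : ℝ) = (l.leaves.card : ℝ) + r.leaves.card := by
      rw [Finset.card_union_of_disjoint hd, Nat.cast_add]
    set n : ℝ := (l.leaves.card : ℝ) + r.leaves.card with hn
    set W : ℝ := ∑ x ∈ l.leaves, ∑ y ∈ r.leaves, M x y with hW
    have hW0 : 0 ≤ W := Finset.sum_nonneg fun x _ => Finset.sum_nonneg fun y _ => hM.2 x y
    have e1 : ∑ x ∈ l.leaves, ∑ y ∈ l.leaves, M x y * ((node l r).lcaSize x y : ℝ) ^ (k + 1)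
        = ∑ x ∈ l.leaves, ∑ y ∈ l.leaves, M x y * (l.lcaSize x y : ℝ) ^ (k + 1) :=
      Finset.sum_congr rfl fun x hx => Finset.sum_congr rfl fun y hy => by
        rw [lcaSize_node_left hx hy]
    have e2 : ∑ x ∈ r.leaves, ∑ y ∈ r.leaves, M x y * ((node l r).lcaSize x y : ℝ) ^ (k + 1)
        = ∑ x ∈ r.leaves, ∑ y ∈ r.leaves, M x y * (r.lcaSize x y : ℝ) ^ (k + 1) :=
      Finset.sum_congr rfl fun x hx => Finset.sum_congr rfl fun y hy => by
        rw [lcaSize_node_right hd hx hy]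
    have e3 : ∑ x ∈ l.leaves, ∑ y ∈ r.leaves, M x y * ((node l r).lcaSize x y : ℝ) ^ (k + 1)
        = W * n ^ (k + 1) := by
      rw [hW, Finset.sum_mul]
      refine Finset.sum_congr rfl fun x hx => ?_
      rw [Finset.sum_mul]
      refine Finset.sum_congr rfl fun y hy => ?_
      rw [lcaSize_node_left_right hd hx (Finset.disjoint_right.mp hd hy), hcard]
    have e4 : ∑ x ∈ r.leaves, ∑ y ∈ l.leaves, M x y * ((node l r).lcaSize x y : ℝ) ^ (k + 1)
        = W * n ^ (k + 1) := by
      rw [hW, Finset.sum_comm, Finset.sum_mul]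
      refine Finset.sum_congr rfl fun x hx => ?_
      rw [Finset.sum_mul]
      refine Finset.sum_congr rfl fun y hy => ?_
      rw [lcaSize_node_right_left hd hy (Finset.disjoint_left.mp hd hx), hcard, hM.1]
    have hgn := mul_le_mul_of_nonneg_left
      (hg _ _ l.leaves_nonempty.card_pos r.leaves_nonempty.card_pos) hW0
    -- Each crossing pair occurs in both orders, hence the factor 2.
    have key : ∑ x ∈ (node l r).leaves, ∑ y ∈ (node l r).leaves,
        M x y * ((node l r).lcaSize x y : ℝ) ^ (k + 1)
        = (∑ x ∈ l.leaves, ∑ y ∈ l.leaves, M x y * (l.lcaSize x y : ℝ) ^ (k + 1))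
          + (∑ x ∈ r.leaves, ∑ y ∈ r.leaves, M x y * (r.lcaSize x y : ℝ) ^ (k + 1))
          + 2 * (W * n ^ (k + 1)) := by
      simp only [leaves, Finset.sum_union hd, Finset.sum_add_distrib]
      rw [e1, e2, e3, e4]
      ring
    rw [key]
    simp only [sumCost]
    rw [← hW]
    rw [← hn] at hgn
    linarith

end BinTree

/-! ### Charging the recursive sparsest cut algorithm -/

section RecursiveSparsestCut

variable {X : Type*} [DecidableEq X]

theorem recursiveSparsestCut_isClusterTreeOn (S : CutSubroutine X) (A : Finset X)
    (hA : A.Nonempty) : (recursiveSparsestCut S A hA).IsClusterTreeOn A := by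
  induction hn : A.card using Nat.strong_induction_on generalizing A with
  | _ n ih =>
    subst hn
    rw [recursiveSparsestCut]
    split_ifs with h
    · have hc := S.isCut A h
      obtain ⟨h1, h2⟩ := ih _ hc.card_lt _ hc.1 rfl
      obtain ⟨h3, h4⟩ := ih _ hc.card_sdiff_lt _ hc.sdiff_nonempty rfl
      refine ⟨⟨?_, h1, h3⟩, ?_⟩
      · rw [h2, h4]
        exact Finset.disjoint_sdiff
      · rw [BinTree.leaves, h2, h4]
        exact Finset.union_sdiff_of_subset hc.2.1
    · refine ⟨trivial, ?_⟩
      obtain ⟨a, ha⟩ := Finset.card_eq_one.mp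
        (le_antisymm (Nat.le_of_lt_succ (not_le.mp h)) hA.card_pos)
      have := hA.choose_spec
      generalize hA.choose = b at this
      subst ha
      rw [Finset.mem_singleton.mp this, BinTree.leaves]

/-- The weight of a `φ`-sparsest cut of `A`, compared with that of a cut induced by a subtree
of `T`. -/
theorem IsSparsestCut.exists_weight_le {M : X → X → ℝ} (hM : IsSimilarityMatrix M)
    {φ : ℝ} (hφ : 0 ≤ φ) {A Y : Finset X} (h : IsSparsestCut M φ A Y)
    (T : BinTree X) (hT : T.DistinctLeaves) (hA : A ⊆ T.leaves) :
    ∃ Z ⊆ A, (∀ x ∈ Z, ∀ y ∈ A \ Z, A.card ≤ 2 * T.lcaSize x y) ∧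
      2 * (A.card : ℝ) ^ 2 * ∑ x ∈ Y, ∑ y ∈ A \ Y, M x y
        ≤ 9 * φ * ((Y.card : ℝ) * ((A \ Y).card : ℝ)) * ∑ x ∈ Z, ∑ y ∈ A \ Z, M x y := by
  obtain ⟨hc, hmin⟩ := h
  have hA2 : 2 ≤ A.card := by
    have := hc.card_lt
    have := hc.1.card_pos
    omega
  have hAT : A ∩ T.leaves = A := Finset.inter_eq_left.mpr hA
  obtain ⟨Z, hZ, h1, h2, h3⟩ := T.exists_balanced_subset hT A hA2 (by rw [hAT]; omega)
  rw [hAT] at hZ h3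
  have hZc : IsCut A Z := by
    refine ⟨Finset.card_pos.mp (by omega), hZ, fun hAZ => ?_⟩
    have := Finset.card_le_card hAZ
    omega
  refine ⟨Z, hZ, fun x hx y hy => ?_, ?_⟩
  · have := h3 x hx y (Finset.mem_sdiff.mp hy).1 (Finset.mem_sdiff.mp hy).2
    omega
  have hd := hmin Z hZc
  unfold cutDensity at hd
  have hY0 : (0 : ℝ) < (Y.card : ℝ) * ((A \ Y).card : ℝ) :=
    mul_pos (Nat.cast_pos.mpr hc.1.card_pos) (Nat.cast_pos.mpr hc.sdiff_nonempty.card_pos)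
  have hZ0 : (0 : ℝ) < (Z.card : ℝ) * ((A \ Z).card : ℝ) :=
    mul_pos (Nat.cast_pos.mpr hZc.1.card_pos) (Nat.cast_pos.mpr hZc.sdiff_nonempty.card_pos)
  have hV0 : 0 ≤ ∑ x ∈ Z, ∑ y ∈ A \ Z, M x y :=
    Finset.sum_nonneg fun x _ => Finset.sum_nonneg fun y _ => hM.2 x y
  set w := ∑ x ∈ Y, ∑ y ∈ A \ Y, M x y
  set v := ∑ x ∈ Z, ∑ y ∈ A \ Z, M x y
  have hcard : ((A \ Z).card : ℝ) = (A.card : ℝ) - Z.card := by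
    rw [Finset.card_sdiff_of_subset hZ, Nat.cast_sub (Finset.card_le_card hZ)]
  have h1' : (A.card : ℝ) ≤ 3 * Z.card := by exact_mod_cast h1
  have h2' : 3 * (Z.card : ℝ) ≤ 2 * A.card := by exact_mod_cast h2
  -- With n = |A| and z = |Z|, this is (3z - n)(2n - 3z) ≥ 0.
  have hprod : 2 * (A.card : ℝ) ^ 2 ≤ 9 * ((Z.card : ℝ) * ((A \ Z).card : ℝ)) := by
    rw [hcard]
    nlinarith [mul_nonneg (sub_nonneg.mpr h1') (sub_nonneg.mpr h2')]
  have hd' : w ≤ φ * (v / ((Z.card : ℝ) * ((A \ Z).card : ℝ)))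
      * ((Y.card : ℝ) * ((A \ Y).card : ℝ)) := (div_le_iff₀ hY0).mp hd
  have hv : 2 * (A.card : ℝ) ^ 2 * (v / ((Z.card : ℝ) * ((A \ Z).card : ℝ))) ≤ 9 * v := by
    calc _ ≤ 9 * ((Z.card : ℝ) * ((A \ Z).card : ℝ)) * (v / ((Z.card : ℝ) * ((A \ Z).card : ℝ))) :=
          mul_le_mul_of_nonneg_right hprod (div_nonneg hV0 hZ0.le)
      _ = 9 * v := by rw [mul_assoc, mul_div_cancel₀ _ hZ0.ne']
  calc 2 * (A.card : ℝ) ^ 2 * w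
      ≤ 2 * (A.card : ℝ) ^ 2 * (φ * (v / ((Z.card : ℝ) * ((A \ Z).card : ℝ)))
        * ((Y.card : ℝ) * ((A \ Y).card : ℝ))) := mul_le_mul_of_nonneg_left hd' (by positivity)
    _ = φ * ((Y.card : ℝ) * ((A \ Y).card : ℝ))
        * (2 * (A.card : ℝ) ^ 2 * (v / ((Z.card : ℝ) * ((A \ Z).card : ℝ)))) := by ring
    _ ≤ φ * ((Y.card : ℝ) * ((A \ Y).card : ℝ)) * (9 * v) :=
        mul_le_mul_of_nonneg_left hv (mul_nonneg hφ hY0.le)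
    _ = _ := by ring

/-- The charging step: the cost of one sparsest cut of `A` is at most the gain in the truncated
pair sum when the truncation level rises from `m`, the size of the larger part, to `|A|`. -/
theorem IsSparsestCut.charge {M : X → X → ℝ} (hM : IsSimilarityMatrix M)
    {φ : ℝ} (hφ : 0 ≤ φ) {A Y : Finset X} (h : IsSparsestCut M φ A Y)
    (T : BinTree X) (hT : T.DistinctLeaves) (hA : A ⊆ T.leaves) (k : ℕ) {m : ℕ}
    (hm : m = max Y.card (A \ Y).card) :
    2 * ((∑ x ∈ Y, ∑ y ∈ A \ Y, M x y) * (A.card : ℝ) ^ (k + 1))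
      ≤ 9 * φ * ∑ x ∈ A, ∑ y ∈ A, M x y *
          ((min A.card (2 * T.lcaSize x y) : ℕ) ^ (k + 1)
            - ((min m (2 * T.lcaSize x y) : ℕ) : ℝ) ^ (k + 1)) := by
  obtain ⟨Z, hZ, hL, hw⟩ := h.exists_weight_le hM hφ T hT hA
  have hA0 : (0 : ℝ) < A.card := by
    have := h.1.card_lt
    exact_mod_cast (by omega : 0 < A.card)
  have hmA : m ≤ A.card := by
    rw [hm]
    exact max_le h.1.card_lt.le h.1.card_sdiff_lt.le
  have hmA' : (m : ℝ) ≤ A.card := by exact_mod_cast hmA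
  -- The smaller part has |A| - m elements and the larger at most |A|.
  have hYm : (Y.card : ℝ) * ((A \ Y).card : ℝ) ≤ ((A.card : ℝ) - m) * A.card := by
    have hsum : ((A \ Y).card : ℝ) + Y.card = A.card := by
      exact_mod_cast Finset.card_sdiff_add_card_eq_card h.1.2.1
    rcases le_total Y.card (A \ Y).card with hle | hle
    · rw [hm, max_eq_right hle, ← hsum]
      nlinarith [sq_nonneg (Y.card : ℝ)]
    · rw [hm, max_eq_left hle, ← hsum]
      nlinarith [sq_nonneg ((A \ Y).card : ℝ)]
  have hterm : ∀ x y, 0 ≤ M x y * (((min A.card (2 * T.lcaSize x y) : ℕ) : ℝ) ^ (k + 1)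
            - ((min m (2 * T.lcaSize x y) : ℕ) : ℝ) ^ (k + 1)) := fun x y =>
    mul_nonneg (hM.2 x y) (sub_nonneg.mpr (pow_le_pow_left₀ (Nat.cast_nonneg _)
      (Nat.cast_le.mpr (min_le_min_right _ hmA)) _))
  have hgain : ((A.card : ℝ) - m) * (A.card : ℝ) ^ k
      ≤ (A.card : ℝ) ^ (k + 1) - (m : ℝ) ^ (k + 1) := by
    have := mul_le_mul_of_nonneg_left (pow_le_pow_left₀ (Nat.cast_nonneg m) hmA' k)
      (Nat.cast_nonneg (α := ℝ) m)
    rw [pow_succ, pow_succ]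
    linarith
  set v := ∑ x ∈ Z, ∑ y ∈ A \ Z, M x y with hv
  have hv0 : 0 ≤ v := Finset.sum_nonneg fun x _ => Finset.sum_nonneg fun y _ => hM.2 x y
  have hsum : v * (((A.card : ℝ) - m) * (A.card : ℝ) ^ k) ≤ ∑ x ∈ A, ∑ y ∈ A, M x y *
          (((min A.card (2 * T.lcaSize x y) : ℕ) : ℝ) ^ (k + 1)
            - ((min m (2 * T.lcaSize x y) : ℕ) : ℝ) ^ (k + 1)) := by
    calc v * (((A.card : ℝ) - m) * (A.card : ℝ) ^ k)
        ≤ ∑ x ∈ Z, ∑ y ∈ A \ Z, M x y *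
          (((min A.card (2 * T.lcaSize x y) : ℕ) : ℝ) ^ (k + 1)
            - ((min m (2 * T.lcaSize x y) : ℕ) : ℝ) ^ (k + 1)) := by
          rw [hv, Finset.sum_mul]
          refine Finset.sum_le_sum fun x hx => ?_
          rw [Finset.sum_mul]
          refine Finset.sum_le_sum fun y hy => ?_
          -- On pairs cut by Z, 2 `lcaSize` ≥ |A| ≥ m, so the two minima are exactly |A| and m.
          have hLxy := hL x hx y hy
          rw [min_eq_left hLxy, min_eq_left (hmA.trans hLxy)]
          exact mul_le_mul_of_nonneg_left hgain (hM.2 x y)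
      _ ≤ ∑ x ∈ Z, ∑ y ∈ A, M x y *
          (((min A.card (2 * T.lcaSize x y) : ℕ) : ℝ) ^ (k + 1)
            - ((min m (2 * T.lcaSize x y) : ℕ) : ℝ) ^ (k + 1)) :=
          Finset.sum_le_sum fun x _ => Finset.sum_le_sum_of_subset_of_nonneg
            Finset.sdiff_subset fun y _ _ => hterm x y
      _ ≤ _ := Finset.sum_le_sum_of_subset_of_nonneg hZ
            fun x _ _ => Finset.sum_nonneg fun y _ => hterm x y
  refine le_trans ?_ (mul_le_mul_of_nonneg_left hsum (by positivity))
  have hw' : 2 * (A.card : ℝ) ^ 2 * (∑ x ∈ Y, ∑ y ∈ A \ Y, M x y)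
      ≤ 9 * φ * (((A.card : ℝ) - m) * A.card) * v :=
    hw.trans (mul_le_mul_of_nonneg_right (mul_le_mul_of_nonneg_left hYm (by positivity)) hv0)
  refine le_of_mul_le_mul_right ?_ hA0
  calc _ = 2 * (A.card : ℝ) ^ 2 * (∑ x ∈ Y, ∑ y ∈ A \ Y, M x y) * (A.card : ℝ) ^ k := by ring
    _ ≤ 9 * φ * (((A.card : ℝ) - m) * A.card) * v * (A.card : ℝ) ^ k :=
        mul_le_mul_of_nonneg_right hw' (by positivity)
    _ = _ := by ring

/-- Truncating at |A| is what lets the induction close: each cut uses up only the drop from level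
|A| to level m, leaving the level-m sum to the two recursive calls. -/
theorem sumCost_recursiveSparsestCut_le {M : X → X → ℝ} (hM : IsSimilarityMatrix M)
    {φ : ℝ} (hφ : 0 ≤ φ) {S : CutSubroutine X} (hS : S.IsApprox M φ) {g : ℕ → ℕ → ℝ}
    {c : ℝ} (hc : 0 ≤ c) {k : ℕ}
    (hg : ∀ a b : ℕ, 1 ≤ a → 1 ≤ b → g a b ≤ c * ((a : ℝ) + b) ^ (k + 1))
    (T : BinTree X) (hT : T.DistinctLeaves) (A : Finset X) (hA : A.Nonempty) (hAT : A ⊆ T.leaves) :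
    2 * (recursiveSparsestCut S A hA).sumCost M g
      ≤ 9 * c * φ * ∑ x ∈ A, ∑ y ∈ A,
          M x y * ((min A.card (2 * T.lcaSize x y) : ℕ) : ℝ) ^ (k + 1) := by
  induction hn : A.card using Nat.strong_induction_on generalizing A with
  | _ n ih =>
    subst hn
    have hK : 0 ≤ 9 * c * φ := by positivity
    rw [recursiveSparsestCut]
    split_ifs with h
    · have hcut := S.isCut A h
      have ih1 := ih _ hcut.card_lt _ hcut.1 (hcut.2.1.trans hAT) rfl
      have ih2 := ih _ hcut.card_sdiff_lt _ hcut.sdiff_nonempty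
        (Finset.sdiff_subset.trans hAT) rfl
      have hl1 := (recursiveSparsestCut_isClusterTreeOn S _ hcut.1).2
      have hl2 := (recursiveSparsestCut_isClusterTreeOn S _ hcut.sdiff_nonempty).2
      rw [BinTree.sumCost, hl1, hl2]
      have hch := (hS A h).charge hM hφ T hT hAT k rfl
      set Y := S.cut A
      set m := max Y.card (A \ Y).card with hm
      set w := ∑ x ∈ Y, ∑ y ∈ A \ Y, M x y
      have hw0 : 0 ≤ w := Finset.sum_nonneg fun x _ => Finset.sum_nonneg fun y _ => hM.2 x y
      have hcard : (Y.card : ℝ) + ((A \ Y).card : ℝ) = A.card := by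
        rw [add_comm]
        exact_mod_cast Finset.card_sdiff_add_card_eq_card hcut.2.1
      have hgw : w * g Y.card (A \ Y).card ≤ w * (c * (A.card : ℝ) ^ (k + 1)) := by
        rw [← hcard]
        exact mul_le_mul_of_nonneg_left
          (hg _ _ hcut.1.card_pos hcut.sdiff_nonempty.card_pos) hw0
      -- Both parts are raised to the common level m, and y is then allowed to range over all of A,
      -- so that the sums over the two parts recombine into one over A.
      have hmono : ∀ B : Finset X, B.card ≤ m →
          (∑ x ∈ B, ∑ y ∈ B, M x y * ((min B.card (2 * T.lcaSize x y) : ℕ) : ℝ) ^ (k + 1))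
            ≤ ∑ x ∈ B, ∑ y ∈ B, M x y * ((min m (2 * T.lcaSize x y) : ℕ) : ℝ) ^ (k + 1) :=
        fun B hB => Finset.sum_le_sum fun x _ => Finset.sum_le_sum fun y _ =>
          mul_le_mul_of_nonneg_left (pow_le_pow_left₀ (Nat.cast_nonneg _)
            (Nat.cast_le.mpr (min_le_min_right _ hB)) _) (hM.2 x y)
      have hterm : ∀ x y, 0 ≤ M x y * ((min m (2 * T.lcaSize x y) : ℕ) : ℝ) ^ (k + 1) :=
        fun x y => mul_nonneg (hM.2 x y) (by positivity)
      have hsub : ∀ B ⊆ A, ∀ f : X → X → ℝ, (∀ x y, 0 ≤ f x y) →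
          ∑ x ∈ B, ∑ y ∈ B, f x y ≤ ∑ x ∈ B, ∑ y ∈ A, f x y :=
        fun B hB f hf => Finset.sum_le_sum fun x _ =>
          Finset.sum_le_sum_of_subset_of_nonneg hB fun y _ _ => hf x y
      have hsplit := Finset.sum_sdiff hcut.2.1 (f := fun x =>
        ∑ y ∈ A, M x y * ((min m (2 * T.lcaSize x y) : ℕ) : ℝ) ^ (k + 1))
      have b1 := (hmono Y (le_max_left _ _)).trans (hsub Y hcut.2.1 _ hterm)
      have b2 := (hmono (A \ Y) (le_max_right _ _)).trans (hsub _ Finset.sdiff_subset _ hterm)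
      have b3 := mul_le_mul_of_nonneg_left (add_le_add b2 b1) hK
      rw [hsplit] at b3
      simp only [mul_sub, Finset.sum_sub_distrib] at hch
      have hch' := mul_le_mul_of_nonneg_left hch hc
      linarith
    · rw [BinTree.sumCost, mul_zero]
      exact mul_nonneg hK (Finset.sum_nonneg fun x _ => Finset.sum_nonneg fun y _ =>
        mul_nonneg (hM.2 x y) (by positivity))

/-- The approximation guarantee for any scaling function of the order of `(a + b) ^ (k + 1)`. -/
theorem sumCost_recursiveSparsestCut_le_sumCost [Fintype X] [Nonempty X] {M : X → X → ℝ}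
    (hM : IsSimilarityMatrix M) {φ : ℝ} (hφ : 0 ≤ φ) {S : CutSubroutine X} (hS : S.IsApprox M φ)
    {g : ℕ → ℕ → ℝ} {c d : ℝ} (hc : 0 < c) (hd : 0 ≤ d) {k : ℕ}
    (hlow : ∀ a b : ℕ, 1 ≤ a → 1 ≤ b → c * ((a : ℝ) + b) ^ (k + 1) ≤ g a b)
    (hup : ∀ a b : ℕ, 1 ≤ a → 1 ≤ b → g a b ≤ d * ((a : ℝ) + b) ^ (k + 1))
    (T : BinTree X) (hT : T.IsClusterTreeOn Finset.univ) :
    (recursiveSparsestCut S Finset.univ Finset.univ_nonempty).sumCost M g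
      ≤ 9 * 2 ^ (k + 1) * d / c * φ * T.sumCost M g := by
  have h1 := sumCost_recursiveSparsestCut_le hM hφ hS hd hup T hT.1 Finset.univ
    Finset.univ_nonempty hT.2.ge
  have h2 := T.sum_lcaSize_pow_le_sumCost hM hlow hT.1
  rw [hT.2] at h2
  have h3 : ∑ x : X, ∑ y : X, M x y *
        ((min (Finset.univ : Finset X).card (2 * T.lcaSize x y) : ℕ) : ℝ) ^ (k + 1)
      ≤ 2 ^ (k + 1) * ∑ x : X, ∑ y : X, M x y * (T.lcaSize x y : ℝ) ^ (k + 1) := by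
    simp only [Finset.mul_sum]
    refine Finset.sum_le_sum fun x _ => Finset.sum_le_sum fun y _ => ?_
    rw [mul_left_comm, ← mul_pow]
    refine mul_le_mul_of_nonneg_left (pow_le_pow_left₀ (Nat.cast_nonneg _) ?_ _) (hM.2 x y)
    exact_mod_cast min_le_right _ _
  set P := ∑ x : X, ∑ y : X, M x y * (T.lcaSize x y : ℝ) ^ (k + 1)
  have h4 : P ≤ 2 * T.sumCost M g / c := by
    rw [le_div_iff₀ hc, mul_comm]
    exact h2
  have hK : 0 ≤ 9 * d * φ := by positivity
  have h5 := h1.trans (mul_le_mul_of_nonneg_left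
    (h3.trans (mul_le_mul_of_nonneg_left h4 (by positivity))) hK)
  have h6 : 9 * d * φ * (2 ^ (k + 1) * (2 * T.sumCost M g / c))
      = 2 * (9 * 2 ^ (k + 1) * d / c * φ * T.sumCost M g) := by ring
  linarith

end RecursiveSparsestCut

/-! ### Growth of the cubic scaling function -/

/-- Under the hypotheses on its coefficients, the cubic scaling function is of the order of a
power of `a + b`. -/
theorem exists_cubicScaling_bounds (lam mu nu : ℝ) (hlam : 0 ≤ lam) (hmu : 0 ≤ mu)
    (hpos : 0 < lam + 2 * mu + nu) :
    ∃ (k : ℕ) (c d : ℝ), 0 < c ∧ 0 < d ∧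
      (∀ a b : ℕ, 1 ≤ a → 1 ≤ b → c * ((a : ℝ) + b) ^ (k + 1) ≤ cubicScaling lam mu nu a b) ∧
      ∀ a b : ℕ, 1 ≤ a → 1 ≤ b → cubicScaling lam mu nu a b ≤ d * ((a : ℝ) + b) ^ (k + 1) := by
  -- Put n = a + b. From ab ≤ n²/4 and n ≥ 2, the cubic part is at least n³/2 + n and the quadratic
  -- part at least 3n²/4 + 2n. The spare linear terms absorb a negative `nu` through `hpos`;
  -- equality holds at a = b = 1.
  have low : ∀ a b : ℕ, 1 ≤ a → 1 ≤ b →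
      lam / 2 * ((a : ℝ) + b) ^ 3 + 3 / 4 * mu * ((a : ℝ) + b) ^ 2
        + (lam + 2 * mu + nu) * ((a : ℝ) + b) ≤ cubicScaling lam mu nu a b := by
    intro a b ha hb
    have ha' : (1 : ℝ) ≤ a := by exact_mod_cast ha
    have hb' : (1 : ℝ) ≤ b := by exact_mod_cast hb
    have hn : 0 ≤ (a : ℝ) + b - 2 := by linarith
    have hn0 : 0 ≤ (a : ℝ) + b := by linarith
    have hq : 4 * ((a : ℝ) * b) ≤ ((a : ℝ) + b) ^ 2 := by nlinarith [sq_nonneg ((a : ℝ) - b)]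
    have e1 : 0 ≤ ((a : ℝ) + b) ^ 3 / 2 - ((a : ℝ) + b) * ((a : ℝ) * b) - ((a : ℝ) + b) := by
      nlinarith [mul_le_mul_of_nonneg_left hq hn0, mul_nonneg (mul_nonneg hn0 hn)
        (by linarith : (0 : ℝ) ≤ (a : ℝ) + b + 2)]
    have e2 : 0 ≤ 5 / 4 * ((a : ℝ) + b) ^ 2 - (a : ℝ) * b - 2 * ((a : ℝ) + b) := by
      nlinarith [mul_nonneg hn0 hn]
    unfold cubicScaling
    nlinarith [mul_nonneg hlam e1, mul_nonneg hmu e2]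
  have up : ∀ a b : ℕ, cubicScaling lam mu nu a b ≤
      lam * ((a : ℝ) + b) ^ 3 + 2 * mu * ((a : ℝ) + b) ^ 2 + |nu| * ((a : ℝ) + b) := by
    intro a b
    unfold cubicScaling
    have e1 : 0 ≤ lam * (((a : ℝ) + b) * a * b) := by positivity
    have e2 : 0 ≤ mu * ((a : ℝ) * b) := by positivity
    have e3 : nu * ((a : ℝ) + b) ≤ |nu| * ((a : ℝ) + b) :=
      mul_le_mul_of_nonneg_right (le_abs_self nu) (by positivity)
    linarith
  have one_le : ∀ a b : ℕ, 1 ≤ a → (1 : ℝ) ≤ (a : ℝ) + b := fun a b ha => by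
    exact_mod_cast le_add_right ha
  have hnu := abs_nonneg nu
  -- The exponent k + 1 is the degree of the leading nonzero term.
  rcases hlam.eq_or_lt with rfl | hlam'
  · rcases hmu.eq_or_lt with rfl | hmu'
    · have hnu' : 0 < nu := by linarith
      refine ⟨0, nu, nu, hnu', hnu', fun a b _ _ => ?_, fun a b _ _ => ?_⟩ <;>
        simp [cubicScaling]
    · refine ⟨1, 3 / 4 * mu, 2 * mu + |nu|, by positivity, by positivity,
        fun a b ha hb => ?_, fun a b ha hb => ?_⟩
      · have h1 := low a b ha hb
        have h2 : 0 ≤ (0 + 2 * mu + nu) * ((a : ℝ) + b) := by positivity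
        norm_num at h1 h2 ⊢
        linarith
      · have h1 := up a b
        have h2 := mul_le_mul_of_nonneg_left
          (le_self_pow₀ (one_le a b ha) two_ne_zero) hnu
        norm_num at h1 ⊢
        linarith
  · refine ⟨2, lam / 2, lam + 2 * mu + |nu|, by positivity, by positivity,
      fun a b ha hb => ?_, fun a b ha hb => ?_⟩
    · have h1 := low a b ha hb
      have h2 : 0 ≤ (lam + 2 * mu + nu) * ((a : ℝ) + b) := by positivity
      have h3 : 0 ≤ 3 / 4 * mu * ((a : ℝ) + b) ^ 2 := by positivity
      norm_num at h1 h2 ⊢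
      linarith
    · have h1 := up a b
      have h2 := mul_le_mul_of_nonneg_left
        (le_self_pow₀ (one_le a b ha) three_ne_zero) hnu
      have h3 := mul_le_mul_of_nonneg_left
        (pow_le_pow_right₀ (one_le a b ha) (by norm_num : 2 ≤ 3)) (mul_nonneg zero_le_two hmu)
      norm_num at h1 ⊢
      linarith

theorem mainTheorem5 (lam mu nu : ℝ) (hlam : 0 ≤ lam) (hmu : 0 ≤ mu)
    (hpos : 0 < lam + 2 * mu + nu) :
    ∃ C : ℝ, 0 < C ∧
      ∀ (X : Type*) [Fintype X] [DecidableEq X] [Nonempty X]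
        (M : X → X → ℝ), IsSimilarityMatrix M →
      ∀ φ : ℝ, 1 ≤ φ →
      ∀ S : CutSubroutine X, S.IsApprox M φ →
        (recursiveSparsestCut S Finset.univ Finset.univ_nonempty).IsClusterTreeOn Finset.univ ∧
        ∀ T : BinTree X, T.IsClusterTreeOn Finset.univ →
          (recursiveSparsestCut S Finset.univ Finset.univ_nonempty).sumCost M
              (cubicScaling lam mu nu)
            ≤ C * φ * T.sumCost M (cubicScaling lam mu nu) := by
  obtain ⟨k, c, d, hc, hd, hlow, hup⟩ := exists_cubicScaling_bounds lam mu nu hlam hmu hpos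
  refine ⟨9 * 2 ^ (k + 1) * d / c, by positivity, fun X _ _ _ M hM φ hφ S hS => ⟨?_, ?_⟩⟩
  · exact recursiveSparsestCut_isClusterTreeOn S _ _
  · exact fun T hT => sumCost_recursiveSparsestCut_le_sumCost hM (by linarith) hS hc hd.le
      hlow hup T hT
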